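/- For $v,w\in\mathbb{R}^2$ write $v\times w=v_1w_2-v_2w_1$. Let $S\subset\mathbb{R}^2$ be a closed and bounded set containing the origin which is star-shaped with respect to the origin, i.e. for every $r\in S$ the segment from $0$ to $r$ lies in $S$. Assume that $S$ has a piecewise smooth, positively oriented boundary: there are finitely many arcs $\gamma_1,\dots,\gamma_n:[0,1]\to\mathbb{R}^2$, each continuously differentiable with nowhere vanishing derivative, such that - $\partial S=\bigcup_i\gamma_i([0,1])$; - the arcs do not overlap: if $\gamma_i(u)=\gamma_j(v)$ with $u\in(0,1)$ and $v\in[0,1]$, then $i=j$ and $u=v$ (so arcs may meet only at end points); - $S$ lies to the left of each arc and its complement to the right: if $N$ denotes $\gamma_i'(u)$ rotated counterclockwise by a right angle, $u\in(0,1)$, then $\gamma_i(u)+\varepsilon N\in S$ and $\gamma_i(u)-\varepsilon N\notin S$ for all sufficiently small $\varepsilon>0$. Let $\rho:S\to\mathbb{R}$ be continuously differentiable on $S$. Then all the integrals below exist, and $$\int_S\rho(r)\,dA=\oint_{\partial S}\left(\int_0^1 t\,\rho(t r)\,dt\right)(r\times\tau)\,ds,$$ where $s$ is arclength and $\tau$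 is the unit tangent vector of $\partial S$, that is, $\oint_{\partial S}f(r,\tau)\,ds=\sum_{i=1}^n\int_0^1 f\bigl(\gamma_i(u),\gamma_i'(u)/|\gamma_i'(u)|\bigr)\,|\gamma_i'(u)|\,du$. -/

import Mathlib

open MeasureTheory Set Filter Topology

/-- The Euclidean plane. -/
abbrev Plane : Type := EuclideanSpace ℝ (Fin 2)

/-- The scalar cross product `v × w = v₁ w₂ - v₂ w₁` of plane vectors. -/
def cross (v w : Plane) : ℝ := v 0 * w 1 - v 1 * w 0

/-- The counterclockwise rotation by a right angle, `(a, b) ↦ (-b, a)`. -/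
def rotLeft (v : Plane) : Plane := !₂[-v 1, v 0]

/-- The velocity of a curve parametrized by `[0, 1]` (one-sided at the end points). -/
noncomputable def velocity (γ : ℝ → Plane) (u : ℝ) : Plane :=
  derivWithin γ (Icc 0 1) u

/-- The unit tangent vector `τ` of a curve parametrized by `[0, 1]`. -/
noncomputable def unitTangent (γ : ℝ → Plane) (u : ℝ) : Plane :=
  ‖velocity γ u‖⁻¹ • velocity γ u

/-- A smooth arc: continuously differentiable on `[0, 1]` with nowhere vanishing velocity. -/
structure IsSmoothArc (γ : ℝ → Plane) : Prop where
  contDiffOn : ContDiffOn ℝ 1 γ (Icc 0 1)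
  velocity_ne_zero : ∀ u ∈ Icc (0 : ℝ) 1, velocity γ u ≠ 0

/-- The arcs `γ 0, …, γ (n - 1)` exhibit the boundary of `S` as piecewise smooth and orient it
positively: they are smooth arcs which together trace out exactly the boundary, they do not overlap
(an interior point of an arc is passed only once; arcs may share end points, and the two end points
of one arc may coincide), and `S` lies to the left of each arc and its complement to the right. -/
structure IsPiecewiseSmoothBoundary (S : Set Plane) {n : ℕ} (γ : Fin n → ℝ → Plane) : Prop where
  smooth : ∀ i, IsSmoothArc (γ i)
  cover : ⋃ i, γ i '' Icc 0 1 = frontier S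
  nonoverlap : ∀ i j, ∀ u ∈ Ioo (0 : ℝ) 1, ∀ v ∈ Icc (0 : ℝ) 1,
    γ i u = γ j v → i = j ∧ u = v
  left_mem : ∀ i, ∀ u ∈ Ioo (0 : ℝ) 1,
    ∀ᶠ ε : ℝ in 𝓝[>] 0, γ i u + ε • rotLeft (velocity (γ i) u) ∈ S
  right_notMem : ∀ i, ∀ u ∈ Ioo (0 : ℝ) 1,
    ∀ᶠ ε : ℝ in 𝓝[>] 0, γ i u - ε • rotLeft (velocity (γ i) u) ∉ S

/-- The pull-back to `[0, 1]` of `f(r, τ) ds`, where `ds = ‖γ'(u)‖ du`. -/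
noncomputable def arcIntegrand (f : Plane → Plane → ℝ) (γ : ℝ → Plane) (u : ℝ) : ℝ :=
  f (γ u) (unitTangent γ u) * ‖velocity γ u‖

/-- The boundary integral `∮ f(r, τ) ds` with respect to arclength over finitely many arcs. -/
noncomputable def boundaryIntegral {n : ℕ} (γ : Fin n → ℝ → Plane)
    (f : Plane → Plane → ℝ) : ℝ :=
  ∑ i, ∫ u in (0 : ℝ)..1, arcIntegrand f (γ i) u

/-- The dilation integral `∫₀¹ t ρ(t r) dt`. -/
noncomputable def dilationIntegral (ρ : Plane → ℝ) (r : Plane) : ℝ :=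
  ∫ t in (0 : ℝ)..1, t * ρ (t • r)

/-!
The cone `(t, u) ↦ t γ(u)` over a boundary arc `γ` has Jacobian `t (γ × γ')`, so the right-hand side
of the formula is the sum of the integrals of `ρ` over the cones, counted with multiplicity and
sign.

* The cones lie in `S` because `S` is star-shaped, and they exhaust `S` up to the origin because a
  ray from the origin leaves the bounded set `S` through its boundary. The critical values are
  negligible by Sard's theorem.
* If the radius to `γ(u)` is transverse to `γ`, the cone covers a neighbourhood of every `t γ(u)`
  with `0 < t < 1`. These points are therefore interior to `S`, so that the radius meets the
  boundary at most at its ends: up to null sets, the cones cover each point of `S` once.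
* The sign `γ × γ' ≥ 0` is the positive orientation: were it negative, the outward normal would
  point into the cone, that is, into `S`.
-/

/-- The cone over the curve `γ`: the map `(t, u) ↦ t γ(u)`, which for `0 ≤ t ≤ 1` sweeps out the
radii to the points of `γ`. Its parameters are encoded as points of the plane because the change of
variables formula is about self-maps. -/
noncomputable def coneMap (γ : ℝ → Plane) (p : Plane) : Plane := p 0 • γ (p 1)

/-- The linear map with columns `x` and `y`, which is the form of the derivative of a cone map. -/
noncomputable def columnMap (x y : Plane) : Plane →L[ℝ] Plane :=
  (EuclideanSpace.proj (0 : Fin 2) : Plane →L[ℝ] ℝ).smulRight x +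
    (EuclideanSpace.proj (1 : Fin 2) : Plane →L[ℝ] ℝ).smulRight y

/-- The square `I × I`, as a set of plane vectors. -/
def square (I : Set ℝ) : Set Plane := {p | ∀ k, p k ∈ I}

/-- The regular parameters of the cone over `γ`: those in the open unit square at which the radius
is transverse to the curve. -/
def regularParameters (γ : ℝ → Plane) : Set Plane :=
  {p ∈ square (Ioo 0 1) | cross (γ (p 1)) (velocity γ (p 1)) ≠ 0}

theorem cross_smul_right (x y : Plane) (c : ℝ) : cross x (c • y) = c * cross x y := by
  simp only [cross, PiLp.smul_apply, smul_eq_mul]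
  ring

theorem cross_neg_left (x y : Plane) : cross (-x) y = -cross x y := by
  simp only [cross, PiLp.neg_apply]
  ring

theorem cross_rotLeft_self (v : Plane) : cross (rotLeft v) v = -‖v‖ ^ 2 := by
  simp only [cross, rotLeft, EuclideanSpace.norm_sq_eq, Fin.sum_univ_two, Real.norm_eq_abs, sq_abs,
    PiLp.toLp_apply, Matrix.cons_val_zero, Matrix.cons_val_one]
  ring

theorem continuousOn_cross {X : Type*} [TopologicalSpace X] {f g : X → Plane} {s : Set X}
    (hf : ContinuousOn f s) (hg : ContinuousOn g s) :
    ContinuousOn (fun x => cross (f x) (g x)) s := by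
  unfold cross
  fun_prop

theorem columnMap_apply (x y w : Plane) : columnMap x y w = w 0 • x + w 1 • y := rfl

theorem cross_columnMap_right (x y w : Plane) : cross (columnMap x y w) y = w 0 * cross x y := by
  simp only [columnMap_apply, cross, PiLp.add_apply, PiLp.smul_apply, smul_eq_mul]
  ring

theorem det_columnMap (x y : Plane) : (columnMap x y).det = cross x y := by
  rw [ContinuousLinearMap.det,
    ← LinearMap.det_toMatrix (EuclideanSpace.basisFun (Fin 2) ℝ).toBasis, Matrix.det_fin_two]
  simp [LinearMap.toMatrix_apply, columnMap_apply, cross, mul_comm]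

theorem norm_smul_unitTangent (γ : ℝ → Plane) (u : ℝ) :
    ‖velocity γ u‖ • unitTangent γ u = velocity γ u := by
  rcases eq_or_ne (velocity γ u) 0 with hv | hv
  · simp [unitTangent, hv]
  · exact smul_inv_smul₀ (norm_ne_zero_iff.2 hv) _

theorem arcIntegrand_mul_cross (f : Plane → ℝ) (γ : ℝ → Plane) (u : ℝ) :
    arcIntegrand (fun r τ => f r * cross r τ) γ u = f (γ u) * cross (γ u) (velocity γ u) := by
  rw [arcIntegrand, mul_assoc, mul_comm (cross _ _), ← cross_smul_right, norm_smul_unitTangent]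

theorem square_mono {I J : Set ℝ} (h : I ⊆ J) : square I ⊆ square J := fun _ hp k => h (hp k)

theorem regularParameters_subset (γ : ℝ → Plane) : regularParameters γ ⊆ square (Icc 0 1) :=
  (sep_subset _ _).trans (square_mono Ioo_subset_Icc_self)

theorem isOpen_square_Ioo (a b : ℝ) : IsOpen (square (Ioo a b)) := by
  simp only [square, ofPred_forall]
  exact isOpen_iInter_of_finite fun k => isOpen_Ioo.preimage (PiLp.continuous_apply 2 _ k)

theorem square_Ioo_ae_eq_square_Icc (a b : ℝ) :
    square (Ioo a b) =ᵐ[volume] square (Icc a b) := by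
  have hpi : univ.pi (fun _ : Fin 2 => Ioo a b) =ᵐ[volume] univ.pi fun _ => Icc a b :=
    Measure.pi_Ioo_ae_eq_pi_Icc
  have hsquare (I : Set ℝ) : square I = WithLp.ofLp ⁻¹' univ.pi fun _ : Fin 2 => I := by
    ext p
    simp [square]
  rw [hsquare, hsquare]
  exact (PiLp.volume_preserving_ofLp (Fin 2)).quasiMeasurePreserving.preimage_ae_eq hpi

theorem setIntegral_square_Ioo {E : Type*} [NormedAddCommGroup E] [NormedSpace ℝ E]
    {f : ℝ → ℝ → E} (hf : IntegrableOn f.uncurry (Icc 0 1 ×ˢ Icc 0 1)) :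
    ∫ p in square (Ioo 0 1), f (p 0) (p 1) = ∫ u in (0 : ℝ)..1, ∫ t in (0 : ℝ)..1, f t u := by
  let e : Plane ≃ᵐ ℝ × ℝ :=
    (MeasurableEquiv.toLp 2 (Fin 2 → ℝ)).symm.trans MeasurableEquiv.finTwoArrow
  have he : MeasurePreserving e volume volume :=
    (EuclideanSpace.volume_preserving_symm_measurableEquiv_toLp (Fin 2)).trans
      (volume_preserving_finTwoArrow ℝ)
  have hsquare : square (Ioo 0 1) = e ⁻¹' (Ioo 0 1 ×ˢ Ioo 0 1) :=
    Set.ext fun p => Fin.forall_fin_two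
  have hf' : IntegrableOn f.uncurry (Ioo 0 1 ×ˢ Ioo 0 1) (volume.prod volume) :=
    hf.mono_set (prod_mono Ioo_subset_Icc_self Ioo_subset_Icc_self)
  calc ∫ p in square (Ioo 0 1), f (p 0) (p 1)
      = ∫ z in Ioo 0 1 ×ˢ Ioo 0 1, f.uncurry z := by
        rw [hsquare]
        exact he.setIntegral_preimage_emb e.measurableEmbedding f.uncurry _
    _ = ∫ u in Ioo (0 : ℝ) 1, ∫ t in Ioo (0 : ℝ) 1, f t u := by
        rw [Measure.volume_eq_prod, ← setIntegral_prod_swap]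
        exact setIntegral_prod _ hf'.swap
    _ = ∫ u in (0 : ℝ)..1, ∫ t in (0 : ℝ)..1, f t u := by
        simp only [intervalIntegral.integral_of_le zero_le_one, integral_Ioc_eq_integral_Ioo]

theorem eventually_lt_of_hasDerivWithinAt_Ioi_neg {f : ℝ → ℝ} {f' a : ℝ}
    (hf : HasDerivWithinAt f f' (Ioi a) a) (hf' : f' < 0) : ∀ᶠ x in 𝓝[>] a, f x < f a := by
  have hslope : Tendsto (slope f a) (𝓝[>] a) (𝓝 f') :=
    (hasDerivWithinAt_iff_tendsto_slope' self_notMem_Ioi).1 hf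
  filter_upwards [hslope.eventually (gt_mem_nhds hf'), self_mem_nhdsWithin] with x hx hax
  rw [slope_def_field] at hx
  exact sub_neg.1 ((div_neg_iff.1 hx).resolve_left fun h => h.2.not_gt (sub_pos.2 hax)).1

theorem exists_hasDerivAt_lift_line {E F : Type*} [NormedAddCommGroup E] [NormedSpace ℝ E]
    [CompleteSpace E] [NormedAddCommGroup F] [NormedSpace ℝ F] {f : E → F} {f' : E ≃L[ℝ] F} {a : E}
    (hf : HasStrictFDerivAt f (f' : E →L[ℝ] F) a) (w : F) :
    ∃ c : ℝ → E, c 0 = a ∧ HasDerivAt c (f'.symm w) 0 ∧ ∀ᶠ ε in 𝓝 0, f (c ε) = f a + ε • w := by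
  let ℓ : ℝ → F := fun ε => f a + ε • w
  have hℓ₀ : ℓ 0 = f a := by simp [ℓ]
  have hℓ : HasDerivAt ℓ w 0 := by
    simpa [ℓ] using ((hasDerivAt_id (0 : ℝ)).smul_const w).const_add (f a)
  refine ⟨hf.localInverse f f' a ∘ ℓ, ?_, ?_, ?_⟩
  · rw [Function.comp_apply, hℓ₀, hf.localInverse_apply_image]
  · exact HasFDerivAt.comp_hasDerivAt (0 : ℝ) (hℓ₀ ▸ hf.to_localInverse.hasFDerivAt) hℓ
  · exact hℓ.continuousAt.tendsto.eventually (hℓ₀ ▸ hf.eventually_right_inverse)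

theorem exists_one_le_smul_mem_frontier {E : Type*} [NormedAddCommGroup E] [NormedSpace ℝ E]
    {S : Set E} (hS : Bornology.IsBounded S) {x : E} (hx : x ∈ S) (hx₀ : x ≠ 0) :
    ∃ s : ℝ, 1 ≤ s ∧ s • x ∈ frontier S := by
  have : PreconnectedSpace (Ici (1 : ℝ)) := Subtype.preconnectedSpace isPreconnected_Ici
  let ray : Ici (1 : ℝ) → E := fun s => (s : ℝ) • x
  have hray : Continuous ray := by fun_prop
  obtain ⟨R, hR⟩ := hS.exists_norm_le
  have hleaves : ray ⁻¹' S ≠ univ := by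
    refine (ne_univ_iff_exists_notMem _).2
      ⟨⟨max 1 ((R + 1) / ‖x‖), mem_Ici.2 (le_max_left _ _)⟩, fun h => ?_⟩
    have hnorm : R + 1 ≤ ‖max 1 ((R + 1) / ‖x‖) • x‖ := by
      rw [norm_smul, ← div_le_iff₀ (norm_pos_iff.2 hx₀)]
      exact (le_max_right _ _).trans (Real.le_norm_self _)
    linarith [hR _ h]
  have hstarts : (ray ⁻¹' S).Nonempty := ⟨⟨1, self_mem_Ici⟩, by simpa [ray] using hx⟩
  obtain ⟨s, hs⟩ := nonempty_frontier_iff.2 ⟨hstarts, hleaves⟩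
  exact ⟨s, s.2, hray.frontier_preimage_subset S hs⟩

theorem intervalIntegrable_mul_smul {E : Type*} [NormedAddCommGroup E] [NormedSpace ℝ E]
    {S : Set E} (hstar : StarConvex ℝ 0 S) {ρ : E → ℝ} (hρ : ContinuousOn ρ S) {r : E}
    (hr : r ∈ S) :
    IntervalIntegrable (fun t : ℝ => t * ρ (t • r)) volume 0 1 := by
  refine ContinuousOn.intervalIntegrable_of_Icc zero_le_one (continuousOn_id.mul ?_)
  exact hρ.comp (by fun_prop) fun t ht => hstar.smul_mem hr ht.1 ht.2

theorem continuousOn_dilationIntegral {S : Set Plane} (hclosed : IsClosed S)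
    (hstar : StarConvex ℝ (0 : Plane) S) {ρ : Plane → ℝ} (hρ : ContinuousOn ρ S) :
    ContinuousOn (dilationIntegral ρ) S := by
  obtain ⟨σ, hσ⟩ := ContinuousMap.exists_restrict_eq hclosed ⟨S.domRestrict ρ, hρ.domRestrict⟩
  have hcont : Continuous (dilationIntegral σ) := by
    unfold dilationIntegral
    fun_prop
  refine hcont.continuousOn.congr fun r hr => intervalIntegral.integral_congr fun t ht => ?_
  rw [uIcc_of_le zero_le_one] at ht
  have hρσ : σ (t • r) = ρ (t • r) :=
    DFunLike.congr_fun hσ ⟨t • r, hstar.smul_mem hr ht.1 ht.2⟩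
  simp only [hρσ]

section Cone

variable {γ : ℝ → Plane}

theorem hasStrictFDerivAt_coneMap {v p : Plane} (hγ : HasStrictDerivAt γ v (p 1)) :
    HasStrictFDerivAt (coneMap γ) (columnMap (γ (p 1)) (p 0 • v)) p := by
  have hcoord (k : Fin 2) : HasStrictFDerivAt (fun p : Plane => p k)
      (EuclideanSpace.proj k : Plane →L[ℝ] ℝ) p :=
    (EuclideanSpace.proj k : Plane →L[ℝ] ℝ).hasStrictFDerivAt
  refine ((hcoord 0).smul (hγ.hasStrictFDerivAt.comp p (hcoord 1))).congr_fderiv ?_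
  ext w : 1
  simp [columnMap_apply, smul_smul, mul_comm, add_comm]

theorem exists_equiv_hasStrictFDerivAt_coneMap {v p : Plane} (hγ : HasStrictDerivAt γ v (p 1))
    (hp : p 0 ≠ 0) (hv : cross (γ (p 1)) v ≠ 0) :
    ∃ L : Plane ≃L[ℝ] Plane, (L : Plane →L[ℝ] Plane) = columnMap (γ (p 1)) (p 0 • v) ∧
      HasStrictFDerivAt (coneMap γ) (L : Plane →L[ℝ] Plane) p := by
  have hdet : (columnMap (γ (p 1)) (p 0 • v)).det ≠ 0 := by
    rw [det_columnMap, cross_smul_right]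
    exact mul_ne_zero hp hv
  have hL := ContinuousLinearMap.coe_toContinuousLinearEquivOfDetNeZero _ hdet
  exact ⟨_, hL, hL.symm ▸ hasStrictFDerivAt_coneMap hγ⟩

theorem hasStrictDerivAt_velocity (hγ : ContDiffOn ℝ 1 γ (Icc 0 1)) {u : ℝ}
    (hu : u ∈ Ioo (0 : ℝ) 1) : HasStrictDerivAt γ (velocity γ u) u := by
  have hnhds : Icc (0 : ℝ) 1 ∈ 𝓝 u := Icc_mem_nhds hu.1 hu.2
  rw [velocity, derivWithin_of_mem_nhds hnhds]
  exact (hγ.contDiffAt hnhds).hasStrictDerivAt one_ne_zero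

theorem continuousOn_cross_velocity (hγ : ContDiffOn ℝ 1 γ (Icc 0 1)) :
    ContinuousOn (fun u => cross (γ u) (velocity γ u)) (Icc 0 1) :=
  continuousOn_cross hγ.continuousOn
    (hγ.continuousOn_derivWithin (uniqueDiffOn_Icc zero_lt_one) le_rfl)

theorem differentiableOn_coneMap (hγ : DifferentiableOn ℝ γ (Icc 0 1)) :
    DifferentiableOn ℝ (coneMap γ) (square (Icc 0 1)) := by
  have hcoord (k : Fin 2) : Differentiable ℝ fun p : Plane => p k := by fun_prop
  exact (hcoord 0).differentiableOn.smul
    (hγ.comp (hcoord 1).differentiableOn fun p hp => hp 1)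

/-- By `hd`, the direction `d` points to the side of the tangent line on which the origin lies. -/
theorem eventually_add_smul_mem_image_coneMap {v d : Plane} {u : ℝ} (hu : u ∈ Ioo (0 : ℝ) 1)
    (hγ : HasStrictDerivAt γ v u) (hd : cross d v * cross (γ u) v < 0) :
    ∀ᶠ ε : ℝ in 𝓝[>] 0, γ u + ε • d ∈ coneMap γ '' square (Ioo 0 1) := by
  obtain ⟨L, hL, hcone⟩ := exists_equiv_hasStrictFDerivAt_coneMap (p := !₂[1, u]) hγ one_ne_zero
    (right_ne_zero_of_mul hd.ne)
  obtain ⟨c, hc₀, hc, hlift⟩ := exists_hasDerivAt_lift_line hcone d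
  have hcoord (k : Fin 2) : HasDerivAt (fun ε => c ε k) (L.symm d k) 0 :=
    (EuclideanSpace.proj k : Plane →L[ℝ] ℝ).hasFDerivAt.comp_hasDerivAt 0 hc
  have hinward : L.symm d 0 < 0 := by
    have hLd : columnMap (γ u) v (L.symm d) = d := by
      simpa using (DFunLike.congr_fun hL (L.symm d)).symm.trans (L.apply_symm_apply d)
    have hcramer : cross d v = L.symm d 0 * cross (γ u) v := by
      rw [← cross_columnMap_right, hLd]
    rw [hcramer, mul_assoc] at hd
    exact neg_of_mul_neg_left hd (mul_self_nonneg _)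
  have hlim (k : Fin 2) : Tendsto (fun ε => c ε k) (𝓝[>] 0) (𝓝 (!₂[1, u] k)) :=
    hc₀ ▸ (hcoord k).continuousAt.tendsto.mono_left nhdsWithin_le_nhds
  filter_upwards [hlift.filter_mono nhdsWithin_le_nhds,
    eventually_lt_of_hasDerivWithinAt_Ioi_neg (hcoord 0).hasDerivWithinAt hinward,
    (hlim 0).eventually (lt_mem_nhds one_pos), (hlim 1).eventually (Ioo_mem_nhds hu.1 hu.2)]
    with ε hε hlt hpos hmem
  refine ⟨c ε, Fin.forall_fin_two.2 ⟨⟨hpos, ?_⟩, hmem⟩, ?_⟩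
  · simpa [hc₀] using hlt
  · simpa [coneMap] using hε

theorem isOpen_regularParameters (hγ : ContDiffOn ℝ 1 γ (Icc 0 1)) :
    IsOpen (regularParameters γ) := by
  have hcross : ContinuousOn (fun p : Plane => cross (γ (p 1)) (velocity γ (p 1)))
      (square (Ioo 0 1)) :=
    (continuousOn_cross_velocity hγ).comp (PiLp.continuous_apply 2 _ 1).continuousOn
      fun p hp => Ioo_subset_Icc_self (hp 1)
  exact hcross.isOpen_inter_preimage (isOpen_square_Ioo 0 1) isOpen_compl_singleton

theorem isOpen_image_coneMap_regularParameters (hγ : ContDiffOn ℝ 1 γ (Icc 0 1)) :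
    IsOpen (coneMap γ '' regularParameters γ) := by
  refine isOpen_iff_mem_nhds.2 ?_
  rintro _ ⟨p, hp, rfl⟩
  obtain ⟨L, -, hL⟩ := exists_equiv_hasStrictFDerivAt_coneMap
    (hasStrictDerivAt_velocity hγ (hp.1 1)) (hp.1 0).1.ne' hp.2
  rw [← hL.map_nhds_eq_of_equiv]
  exact image_mem_map ((isOpen_regularParameters hγ).mem_nhds hp)

theorem hasFDerivWithinAt_coneMap (hγ : ContDiffOn ℝ 1 γ (Icc 0 1)) {s : Set Plane} {p : Plane}
    (hp : p ∈ square (Ioo 0 1)) :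
    HasFDerivWithinAt (coneMap γ) (columnMap (γ (p 1)) (p 0 • velocity γ (p 1))) s p :=
  (hasStrictFDerivAt_coneMap
    (hasStrictDerivAt_velocity hγ (hp 1))).hasFDerivAt.hasFDerivWithinAt

/-- The critical values are negligible by Sard's theorem, and the edges of the square because a
differentiable map preserves null sets. -/
theorem volume_image_coneMap_sdiff_regularParameters (hγ : ContDiffOn ℝ 1 γ (Icc 0 1)) :
    volume (coneMap γ '' (square (Icc 0 1) \ regularParameters γ)) = 0 := by
  let critical : Set Plane := {p ∈ square (Ioo 0 1) | cross (γ (p 1)) (velocity γ (p 1)) = 0}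
  have hcritical : volume (coneMap γ '' critical) = 0 :=
    addHaar_image_eq_zero_of_det_fderivWithin_eq_zero volume
      (fun p hp => hasFDerivWithinAt_coneMap hγ hp.1)
      (fun p hp => by rw [det_columnMap, cross_smul_right, hp.2, mul_zero])
  have hedges : volume (coneMap γ '' (square (Icc 0 1) \ square (Ioo 0 1))) = 0 :=
    addHaar_image_eq_zero_of_differentiableOn_of_addHaar_eq_zero volume
      ((differentiableOn_coneMap (hγ.differentiableOn one_ne_zero)).mono sdiff_subset)
      (ae_le_set.1 (square_Ioo_ae_eq_square_Icc 0 1).symm.le)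
  refine measure_mono_null ?_ (measure_union_null hcritical hedges)
  rw [← image_union]
  refine image_mono fun p hp => ?_
  by_cases hopen : p ∈ square (Ioo 0 1)
  · exact Or.inl ⟨hopen, by_contra fun hne => hp.2 ⟨hopen, hne⟩⟩
  · exact Or.inr ⟨hp.1, hopen⟩

theorem setIntegral_image_coneMap (hγ : ContDiffOn ℝ 1 γ (Icc 0 1))
    (hinj : InjOn (coneMap γ) (regularParameters γ)) {ρ : Plane → ℝ}
    (hρ : ContinuousOn ρ (coneMap γ '' square (Icc 0 1))) :
    ∫ r in coneMap γ '' regularParameters γ, ρ r =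
      ∫ u in (0 : ℝ)..1, dilationIntegral ρ (γ u) * |cross (γ u) (velocity γ u)| := by
  let F : ℝ → ℝ → ℝ := fun t u => t * ρ (t • γ u) * |cross (γ u) (velocity γ u)|
  have hF : ContinuousOn F.uncurry (Icc 0 1 ×ˢ Icc 0 1) := by
    have hsnd : MapsTo Prod.snd (Icc (0 : ℝ) 1 ×ˢ Icc (0 : ℝ) 1) (Icc 0 1) := fun z hz => hz.2
    have hcone : ContinuousOn (fun z : ℝ × ℝ => z.1 • γ z.2) (Icc 0 1 ×ˢ Icc 0 1) :=
      continuousOn_fst.smul (hγ.continuousOn.comp continuousOn_snd hsnd)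
    refine (continuousOn_fst.mul (hρ.comp hcone fun z hz => ?_)).mul
      ((continuousOn_cross_velocity hγ).comp continuousOn_snd hsnd).abs
    exact ⟨!₂[z.1, z.2], Fin.forall_fin_two.2 hz, rfl⟩
  have hmeas := (isOpen_regularParameters hγ).measurableSet
  calc ∫ r in coneMap γ '' regularParameters γ, ρ r
      = ∫ p in regularParameters γ, F (p 0) (p 1) := by
        rw [integral_image_eq_integral_abs_det_fderiv_smul volume hmeas
          (fun p hp => hasFDerivWithinAt_coneMap hγ hp.1) hinj]
        refine setIntegral_congr_fun hmeas fun p hp => ?_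
        simp only [F, det_columnMap, cross_smul_right, abs_mul, abs_of_pos (hp.1 0).1, coneMap,
          smul_eq_mul]
        ring
    _ = ∫ p in square (Ioo 0 1), F (p 0) (p 1) := by
        refine (setIntegral_eq_of_subset_of_forall_sdiff_eq_zero
          (isOpen_square_Ioo 0 1).measurableSet (fun p hp => hp.1) fun p hp => ?_).symm
        have hcross : cross (γ (p 1)) (velocity γ (p 1)) = 0 :=
          by_contra fun hne => hp.2 ⟨hp.1, hne⟩
        simp only [F, hcross, abs_zero, mul_zero]
    _ = ∫ u in (0 : ℝ)..1, ∫ t in (0 : ℝ)..1, F t u :=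
        setIntegral_square_Ioo (hF.integrableOn_compact (isCompact_Icc.prod isCompact_Icc))
    _ = ∫ u in (0 : ℝ)..1, dilationIntegral ρ (γ u) * |cross (γ u) (velocity γ u)| := by
        simp only [F, intervalIntegral.integral_mul_const, dilationIntegral]

end Cone

namespace IsPiecewiseSmoothBoundary

variable {S : Set Plane} {n : ℕ} {γ : Fin n → ℝ → Plane}

theorem mem_frontier (hγ : IsPiecewiseSmoothBoundary S γ) (i : Fin n) {u : ℝ}
    (hu : u ∈ Icc (0 : ℝ) 1) : γ i u ∈ frontier S := by
  rw [← hγ.cover]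
  exact mem_iUnion.2 ⟨i, u, hu, rfl⟩

theorem image_coneMap_subset (hγ : IsPiecewiseSmoothBoundary S γ) (hclosed : IsClosed S)
    (hstar : StarConvex ℝ (0 : Plane) S) (i : Fin n) : coneMap (γ i) '' square (Icc 0 1) ⊆ S := by
  rintro _ ⟨p, hp, rfl⟩
  exact hstar.smul_mem (hclosed.frontier_subset (hγ.mem_frontier i (hp 1))) (hp 0).1 (hp 0).2

theorem sdiff_zero_subset_iUnion_image_coneMap (hγ : IsPiecewiseSmoothBoundary S γ)
    (hbdd : Bornology.IsBounded S) : S \ {0} ⊆ ⋃ i, coneMap (γ i) '' square (Icc 0 1) := by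
  rintro x ⟨hxS, hx₀⟩
  obtain ⟨s, hs, hsx⟩ := exists_one_le_smul_mem_frontier hbdd hxS hx₀
  rw [← hγ.cover] at hsx
  obtain ⟨i, u, hu, hux⟩ := mem_iUnion.1 hsx
  have hs₀ : 0 < s := one_pos.trans_le hs
  refine mem_iUnion.2 ⟨i, !₂[s⁻¹, u], Fin.forall_fin_two.2 ⟨?_, hu⟩, ?_⟩
  · exact ⟨(inv_pos.2 hs₀).le, inv_le_one_of_one_le₀ hs⟩
  · change s⁻¹ • γ i u = x
    rw [hux, inv_smul_smul₀ hs₀.ne']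

/-- Otherwise the outward normal would point into the cone over the arc, which lies in `S`. -/
theorem cross_velocity_nonneg (hγ : IsPiecewiseSmoothBoundary S γ) (hclosed : IsClosed S)
    (hstar : StarConvex ℝ (0 : Plane) S) (i : Fin n) {u : ℝ} (hu : u ∈ Ioo (0 : ℝ) 1) :
    0 ≤ cross (γ i u) (velocity (γ i) u) := by
  by_contra! hneg
  have hv : velocity (γ i) u ≠ 0 :=
    (hγ.smooth i).velocity_ne_zero u (Ioo_subset_Icc_self hu)
  have hinward : cross (-rotLeft (velocity (γ i) u)) (velocity (γ i) u) *
      cross (γ i u) (velocity (γ i) u) < 0 := by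
    rw [cross_neg_left, cross_rotLeft_self, neg_neg]
    exact mul_neg_of_pos_of_neg (by positivity) hneg
  have hcone := eventually_add_smul_mem_image_coneMap hu
    (hasStrictDerivAt_velocity (hγ.smooth i).contDiffOn hu) hinward
  obtain ⟨ε, hin, hout⟩ := (hcone.and (hγ.right_notMem i u hu)).exists
  rw [smul_neg, ← sub_eq_add_neg] at hin
  exact hout (hγ.image_coneMap_subset hclosed hstar i
    (image_mono (square_mono Ioo_subset_Icc_self) hin))

theorem image_regularParameters_subset_interior (hγ : IsPiecewiseSmoothBoundary S γ)
    (hclosed : IsClosed S) (hstar : StarConvex ℝ (0 : Plane) S) (i : Fin n) :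
    coneMap (γ i) '' regularParameters (γ i) ⊆ interior S :=
  interior_maximal
    ((image_mono (regularParameters_subset (γ i))).trans
      (hγ.image_coneMap_subset hclosed hstar i))
    (isOpen_image_coneMap_regularParameters (hγ.smooth i).contDiffOn)

/-- If the two parameters had different radial coordinates, the boundary point on one arc would lie
strictly inside a radius that is transverse to the other arc, hence in the interior of `S`. -/
theorem eq_of_coneMap_eq (hγ : IsPiecewiseSmoothBoundary S γ) (hclosed : IsClosed S)
    (hstar : StarConvex ℝ (0 : Plane) S) {i j : Fin n} {p q : Plane}
    (hp : p ∈ regularParameters (γ i)) (hq : q ∈ regularParameters (γ j))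
    (h : coneMap (γ i) p = coneMap (γ j) q) : i = j ∧ p = q := by
  wlog hle : q 0 ≤ p 0 generalizing i j p q
  · exact (this hq hp h.symm (le_of_not_ge hle)).imp Eq.symm Eq.symm
  obtain ⟨hp₀, hp₁⟩ := Fin.forall_fin_two.1 hp.1
  obtain ⟨hq₀, hq₁⟩ := Fin.forall_fin_two.1 hq.1
  have hratio : γ i (p 1) = (q 0 / p 0) • γ j (q 1) := by
    rw [div_eq_inv_mul, mul_smul, ← inv_smul_smul₀ hp₀.1.ne' (γ i (p 1))]
    exact congrArg _ h
  have heq₀ : p 0 = q 0 := by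
    refine le_antisymm (le_of_not_gt fun hlt => ?_) hle
    have hregular : !₂[q 0 / p 0, q 1] ∈ regularParameters (γ j) :=
      ⟨Fin.forall_fin_two.2 ⟨⟨div_pos hq₀.1 hp₀.1, (div_lt_one hp₀.1).2 hlt⟩, hq₁⟩, hq.2⟩
    have hint : γ i (p 1) ∈ interior S := hratio ▸
      hγ.image_regularParameters_subset_interior hclosed hstar j (mem_image_of_mem _ hregular)
    exact (hγ.mem_frontier i (Ioo_subset_Icc_self hp₁)).2 hint
  rw [heq₀, div_self hq₀.1.ne', one_smul] at hratio
  obtain ⟨hij, heq₁⟩ := hγ.nonoverlap i j _ hp₁ _ (Ioo_subset_Icc_self hq₁) hratio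
  exact ⟨hij, PiLp.ext (Fin.forall_fin_two.2 ⟨heq₀, heq₁⟩)⟩

theorem ae_eq_iUnion_image_coneMap (hγ : IsPiecewiseSmoothBoundary S γ) (hclosed : IsClosed S)
    (hbdd : Bornology.IsBounded S) (hstar : StarConvex ℝ (0 : Plane) S) :
    S =ᵐ[volume] ⋃ i, coneMap (γ i) '' regularParameters (γ i) := by
  have hnull : volume ({0} ∪
      ⋃ i, coneMap (γ i) '' (square (Icc 0 1) \ regularParameters (γ i))) = 0 :=
    measure_union_null (measure_singleton 0) <| measure_iUnion_null fun i =>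
      volume_image_coneMap_sdiff_regularParameters (hγ.smooth i).contDiffOn
  refine EventuallyLE.antisymm (ae_le_set.2 (measure_mono_null ?_ hnull)) (LE.le.eventuallyLE ?_)
  · rintro x ⟨hxS, hx⟩
    by_cases hx₀ : x = 0
    · exact Or.inl hx₀
    obtain ⟨i, p, hp, rfl⟩ :=
      mem_iUnion.1 (hγ.sdiff_zero_subset_iUnion_image_coneMap hbdd ⟨hxS, hx₀⟩)
    exact Or.inr (mem_iUnion.2 ⟨i, p, ⟨hp, fun hreg => hx (mem_iUnion.2 ⟨i, p, hreg, rfl⟩)⟩, rfl⟩)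
  · exact iUnion_subset fun i =>
      (hγ.image_regularParameters_subset_interior hclosed hstar i).trans interior_subset

theorem setIntegral_eq_sum_setIntegral_image_coneMap (hγ : IsPiecewiseSmoothBoundary S γ)
    (hclosed : IsClosed S) (hbdd : Bornology.IsBounded S) (hstar : StarConvex ℝ (0 : Plane) S)
    {E : Type*} [NormedAddCommGroup E] [NormedSpace ℝ E] {f : Plane → E} (hf : IntegrableOn f S) :
    ∫ r in S, f r = ∑ i, ∫ r in coneMap (γ i) '' regularParameters (γ i), f r := by
  rw [setIntegral_congr_set (hγ.ae_eq_iUnion_image_coneMap hclosed hbdd hstar)]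
  refine integral_iUnion_fintype
    (fun i => (isOpen_image_coneMap_regularParameters (hγ.smooth i).contDiffOn).measurableSet)
    (fun i j hij => disjoint_left.2 ?_)
    (fun i => hf.mono_set
      ((hγ.image_regularParameters_subset_interior hclosed hstar i).trans interior_subset))
  rintro _ ⟨p, hp, rfl⟩ ⟨q, hq, hqp⟩
  exact hij (hγ.eq_of_coneMap_eq hclosed hstar hp hq hqp.symm).1

theorem intervalIntegrable_arcIntegrand (hγ : IsPiecewiseSmoothBoundary S γ) (hclosed : IsClosed S)
    (i : Fin n) {f : Plane → ℝ} (hf : ContinuousOn f S) :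
    IntervalIntegrable (arcIntegrand (fun r τ => f r * cross r τ) (γ i)) volume 0 1 := by
  have hsmooth := (hγ.smooth i).contDiffOn
  rw [funext (arcIntegrand_mul_cross f (γ i))]
  refine ContinuousOn.intervalIntegrable_of_Icc zero_le_one
    ((hf.comp hsmooth.continuousOn fun u hu => ?_).mul (continuousOn_cross_velocity hsmooth))
  exact hclosed.frontier_subset (hγ.mem_frontier i hu)

theorem setIntegral_image_coneMap_eq_integral_arcIntegrand (hγ : IsPiecewiseSmoothBoundary S γ)
    (hclosed : IsClosed S) (hstar : StarConvex ℝ (0 : Plane) S) (i : Fin n) {ρ : Plane → ℝ}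
    (hρ : ContinuousOn ρ S) :
    ∫ r in coneMap (γ i) '' regularParameters (γ i), ρ r =
      ∫ u in (0 : ℝ)..1, arcIntegrand (fun r τ => dilationIntegral ρ r * cross r τ) (γ i) u := by
  rw [setIntegral_image_coneMap (hγ.smooth i).contDiffOn
    (fun p hp q hq h => (hγ.eq_of_coneMap_eq hclosed hstar hp hq h).2)
    (hρ.mono (hγ.image_coneMap_subset hclosed hstar i))]
  refine intervalIntegral.integral_congr_Ioo_of_le zero_le_one fun u hu => ?_
  simp only [arcIntegrand_mul_cross, abs_of_nonneg (hγ.cross_velocity_nonneg hclosed hstar i hu)]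

end IsPiecewiseSmoothBoundary

theorem mainTheorem2_general (S : Set Plane) (hclosed : IsClosed S) (hbdd : Bornology.IsBounded S)
    (hstar : StarConvex ℝ (0 : Plane) S)
    {n : ℕ} (γ : Fin n → ℝ → Plane) (hγ : IsPiecewiseSmoothBoundary S γ)
    (ρ : Plane → ℝ) (hρ : ContinuousOn ρ S) :
    IntegrableOn ρ S volume ∧
    (∀ r ∈ frontier S, IntervalIntegrable (fun t : ℝ => t * ρ (t • r)) volume 0 1) ∧
    (∀ i, IntervalIntegrable
      (arcIntegrand (fun r τ => dilationIntegral ρ r * cross r τ) (γ i)) volume 0 1) ∧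
    ∫ r in S, ρ r = boundaryIntegral γ (fun r τ => dilationIntegral ρ r * cross r τ) := by
  have hint : IntegrableOn ρ S volume :=
    hρ.integrableOn_compact (Metric.isCompact_of_isClosed_isBounded hclosed hbdd)
  refine ⟨hint, fun r hr => ?_, fun i => ?_, ?_⟩
  · exact intervalIntegrable_mul_smul hstar hρ (hclosed.frontier_subset hr)
  · exact hγ.intervalIntegrable_arcIntegrand hclosed i
      (continuousOn_dilationIntegral hclosed hstar hρ)
  · rw [hγ.setIntegral_eq_sum_setIntegral_image_coneMap hclosed hbdd hstar hint, boundaryIntegral]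
    exact Finset.sum_congr rfl fun i _ =>
      hγ.setIntegral_image_coneMap_eq_integral_arcIntegrand hclosed hstar i hρ

theorem mainTheorem2 (S : Set Plane) (hclosed : IsClosed S) (hbdd : Bornology.IsBounded S)
    (h0 : (0 : Plane) ∈ S) (hstar : StarConvex ℝ (0 : Plane) S)
    {n : ℕ} (γ : Fin n → ℝ → Plane) (hγ : IsPiecewiseSmoothBoundary S γ)
    (ρ : Plane → ℝ) (hρ : ContDiffOn ℝ 1 ρ S) :
    IntegrableOn ρ S volume ∧
    (∀ r ∈ frontier S, IntervalIntegrable (fun t : ℝ => t * ρ (t • r)) volume 0 1) ∧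
    (∀ i, IntervalIntegrable
      (arcIntegrand (fun r τ => dilationIntegral ρ r * cross r τ) (γ i)) volume 0 1) ∧
    ∫ r in S, ρ r = boundaryIntegral γ (fun r τ => dilationIntegral ρ r * cross r τ) :=
  mainTheorem2_general S hclosed hbdd hstar γ hγ ρ hρ.continuousOn
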